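/- Let $K$ be a number field with ring of integers $\mathcal O_K$, and let $y=\sum_{n\ge 0}\mathbf a(n)x^n\in K[[x]]$. For a nonzero prime ideal $\mathfrak p$ of $\mathcal O_K$ let $k(\mathfrak p)$ be its residue field. If $v_{\mathfrak p}(\mathbf a(n))\ge 0$ for all $n$, we say that $\mathbf a_{\mathfrak p}$ is defined, and write $\mathbf a_{\mathfrak p}$ for the sequence in $k(\mathfrak p)$ obtained by reducing $\mathbf a$ modulo $\mathfrak p$. For an integer $q\ge 2$, a $q$-DFAO is a deterministic finite automaton with output, with input alphabet $\{0,\dots,q-1\}$. It generates a sequence $\mathbf b$ in the forward-reading (resp. reverse-reading) convention if for every $n\ge 0$ and every base-$q$ expansion of $n$, with any number of leading zeros (the empty word being an expansion of $0$), its output after reading the digits from the most to the least significant (resp. from the least to the most significant) is $\mathbf b(n)$. Let $N^f_q(\mathbf b)$ (resp. $N_q(\mathbf b)$) be the smallest number of states of a $q$-DFAO that generates $\mathbf b$ in the forward-reading (resp. reverse-reading) convention, and $\infty$ if there is none. Write $N_{\mathfrak p}=N_{|k(\mathfrak p)|}$ and $N^f_{\mathfrak p}=N^f_{|k(\mathfrak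 p)|}$. **Theorem.** The following are equivalent: 1. $\mathbf a_{\mathfrak p}$ is defined for infinitely many $\mathfrak p$, and there is a constant $C$ such that $N_{\mathfrak p}(\mathbf a_{\mathfrak p})\le C$ and $N^f_{\mathfrak p}(\mathbf a_{\mathfrak p})\le C$ for every $\mathfrak p$ for which $\mathbf a_{\mathfrak p}$ is defined. 2. $y$ is the power series expansion of a rational function in $K(x)$ all of whose finite poles (in an algebraic closure of $K$) are simple and are roots of unity; the pole at $\infty$ may be of any order. Moreover, if these conditions hold, then $\mathbf a_{\mathfrak p}$ is defined for all but finitely many $\mathfrak p$. -/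

import Mathlib

open scoped NumberField LaurentSeries
open IsDedekindDomain

/-- A deterministic finite automaton with output (finiteness of the state set `Q` is imposed where
automata are counted): initial state, transition function, output function. -/
structure DFAO (Sig Del Q : Type*) where
  start : Q
  step : Q → Sig → Q
  out : Q → Del

namespace DFAO

variable {Sig Del Q : Type*}

/-- The state reached from the initial state after reading the letters of `w` from left to right. -/
def run (M : DFAO Sig Del Q) (w : List Sig) : Q := w.foldl M.step M.start

/-- The function on words induced under the forward-reading convention. -/
def forwardFun (M : DFAO Sig Del Q) (w : List Sig) : Del := M.out (M.run w)

/-- The function on words induced under the reverse-reading convention. -/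
def reverseFun (M : DFAO Sig Del Q) (w : List Sig) : Del := M.out (M.run w.reverse)

end DFAO

/-- The number with base-`q` expansion `w`, written with the most significant digit first; leading
zeros are allowed, and the empty word is an expansion of `0`. -/
def baseValue (q : ℕ) (w : List (Fin q)) : ℕ :=
  w.foldl (fun n d => q * n + d) 0

/-- `M` generates the sequence `a` in the forward-reading convention: it gives the right output on
every base-`q` expansion of every integer, with any number of leading zeros. -/
def GeneratesForward {q : ℕ} {Del Q : Type*} (M : DFAO (Fin q) Del Q) (a : ℕ → Del) : Prop :=
  ∀ w : List (Fin q), M.forwardFun w = a (baseValue q w)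

/-- `M` generates the sequence `a` in the reverse-reading convention: it gives the right output on
every base-`q` expansion of every integer, with any number of leading zeros. -/
def GeneratesReverse {q : ℕ} {Del Q : Type*} (M : DFAO (Fin q) Del Q) (a : ℕ → Del) : Prop :=
  ∀ w : List (Fin q), M.reverseFun w = a (baseValue q w)

/-- The forward-reading complexity: the least number of states of a forward-reading `q`-DFAO that
generates `a` (`⊤` if there is none, that is, if `a` is not `q`-automatic). -/
noncomputable def forwardComplexity {Del : Type*} (q : ℕ) (a : ℕ → Del) : ℕ∞ :=
  sInf {N : ℕ∞ | ∃ m : ℕ, N = m ∧ ∃ M : DFAO (Fin q) Del (Fin m), GeneratesForward M a}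

/-- The reverse-reading complexity: the least number of states of a reverse-reading `q`-DFAO that
generates `a` (`⊤` if there is none, that is, if `a` is not `q`-automatic). -/
noncomputable def reverseComplexity {Del : Type*} (q : ℕ) (a : ℕ → Del) : ℕ∞ :=
  sInf {N : ℕ∞ | ∃ m : ℕ, N = m ∧ ∃ M : DFAO (Fin q) Del (Fin m), GeneratesReverse M a}

section Reduction

variable {K : Type*} [Field K] [NumberField K]

/-- The sequence `a` is `𝔭`-integral, i.e. `v_𝔭(a n) ≥ 0` for all `n` (the valuation of Mathlib is
written multiplicatively). -/
def IntegralAt (a : ℕ → K) (𝔭 : HeightOneSpectrum (𝓞 K)) : Prop :=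
  ∀ n, 𝔭.valuation K (a n) ≤ 1

/-- The residue field `k(𝔭)`: the residue field of the valuation ring of `K` at `𝔭`. -/
abbrev ResidueFieldAt (K : Type*) [Field K] [NumberField K] (𝔭 : HeightOneSpectrum (𝓞 K)) :=
  IsLocalRing.ResidueField (𝔭.valuation K).valuationSubring

/-- The reduction modulo `𝔭` of a `𝔭`-integral sequence. -/
noncomputable def reduceAt (a : ℕ → K) (𝔭 : HeightOneSpectrum (𝓞 K)) (h : IntegralAt a 𝔭) :
    ℕ → ResidueFieldAt K 𝔭 :=
  fun n => IsLocalRing.residue (𝔭.valuation K).valuationSubring ⟨a n, h n⟩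

end Reduction

/-- The order of the pole of the rational function `r` at the point `z` of the affine line over the
algebraic closure (`0` if there is no pole): the multiplicity of `z` as a root of the denominator
of `r` in lowest terms. -/
noncomputable def poleOrder {K : Type*} [Field K] (r : RatFunc K) (z : AlgebraicClosure K) : ℕ :=
  (r.denom.map (algebraMap K (AlgebraicClosure K))).rootMultiplicity z

/-- `y` is the expansion at `0` of a rational function over `K` all of whose finite poles are simple
and lie at roots of unity. -/
def IsRationalWithSimplePolesAtRootsOfUnity {K : Type*} [Field K] (y : PowerSeries K) : Prop :=
  ∃ r : RatFunc K, (r : K⸨X⸩) = (y : K⸨X⸩) ∧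
    ∀ z : AlgebraicClosure K, 0 < poleOrder r z → poleOrder r z = 1 ∧ ∃ n : ℕ, 0 < n ∧ z ^ n = 1

/-! Both conditions say that the sequence is eventually periodic. For rationality this is
`EventuallyPeriodic.of_isRational` and its converse: multiplying by `X ^ m - 1` turns a series of
eventual period `m` into a polynomial. An eventually periodic sequence factors through a finite
quotient semiring of `ℕ`, and base-`q` expansions can be evaluated there by automata whose size does
not depend on `q` (`exists_complexity_bound`). Conversely, bounded reverse complexity forces `a` to
have finitely many values. At infinitely many `𝔭` the reduction is then injective on these values,
so `a` itself inherits the automata, for arbitrarily large `q` prime to any given integers.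
`eventuallyPeriodic_of_forwardClasses` concludes in the style of Cobham's theorem: two bases with
nearly equal powers give long stretches of `a` local periods prime to `q`, and two equal columns
modulo `q` replace these by one global period. -/

/-! ### A periodicity criterion from automata in several bases. -/

section PeriodicityCriterion

variable {V : Type*}

/-- A sequence is eventually periodic. -/
def EventuallyPeriodic (a : ℕ → V) : Prop :=
  ∃ n₀ h : ℕ, 0 < h ∧ ∀ n, n₀ ≤ n → a (n + h) = a n

/-- There are at most `C` classes of integers such that the blocks `a [q ^ k * n, q ^ k * (n + 1))`
depend only on the class of `n`. -/
def HasForwardClasses (a : ℕ → V) (q C : ℕ) : Prop :=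
  ∃ σ : ℕ → Fin C, ∀ n n', σ n = σ n' →
    ∀ k i, i < q ^ k → a (q ^ k * n + i) = a (q ^ k * n' + i)

/-- Two residue classes modulo `q` with representatives at distance `h` carry the same
subsequence. -/
def HasEqualColumns (a : ℕ → V) (q h : ℕ) : Prop :=
  ∃ d, ∀ n, n ≡ d [MOD q] → a n = a (n + h)

/-- Three consecutive blocks leave room on both sides of the middle one, so that windows can be
shifted across block boundaries. -/
theorem triple_blocks_eq {a : ℕ → V} {q C : ℕ} {σ : ℕ → Fin C}
    (hσ : ∀ n n', σ n = σ n' → ∀ k i, i < q ^ k → a (q ^ k * n + i) = a (q ^ k * n' + i))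
    {n n' : ℕ} (h : (σ n, σ (n + 1), σ (n + 2)) = (σ n', σ (n' + 1), σ (n' + 2)))
    (k j : ℕ) (hj : j < 3 * q ^ k) : a (q ^ k * n + j) = a (q ^ k * n' + j) := by
  simp only [Prod.mk.injEq] at h
  obtain ⟨h0, h1, h2⟩ := h
  rcases lt_or_ge j (q ^ k) with hj0 | hj0
  · exact hσ _ _ h0 k j hj0
  obtain ⟨i, rfl⟩ := Nat.exists_eq_add_of_le hj0
  rcases lt_or_ge i (q ^ k) with hi | hi
  · simpa only [mul_add, mul_one, add_assoc] using hσ _ _ h1 k i hi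
  obtain ⟨l, rfl⟩ := Nat.exists_eq_add_of_le hi
  have := hσ _ _ h2 k l (by omega)
  simpa only [mul_add, mul_two, add_assoc] using this

/-- A value taken infinitely often has as many representatives as desired; the others do not occur
beyond some `n₀`. The bound `N` is uniform in `n`, so a second base can be chosen after it. -/
theorem exists_representatives {T : Type*} [Finite T] (τ : ℕ → T) (M : ℕ) :
    ∃ N n₀ : ℕ, ∀ n, n₀ ≤ n → ∃ S : Finset ℕ, M < S.card ∧ ∀ m ∈ S, m ≤ N ∧ τ m = τ n := by
  classical
  cases nonempty_fintype T
  have key : ∀ c : T, ∃ N n₀ : ℕ, ∀ n, n₀ ≤ n → τ n = c →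
      ∃ S : Finset ℕ, M < S.card ∧ ∀ m ∈ S, m ≤ N ∧ τ m = c := by
    intro c
    by_cases hc : {m | τ m = c}.Infinite
    · obtain ⟨S, hS, hcard⟩ := hc.exists_subset_card_eq (M + 1)
      refine ⟨S.sup id, 0, fun n _ _ => ⟨S, by omega, fun m hm => ⟨?_, hS hm⟩⟩⟩
      exact Finset.le_sup (f := id) hm
    · rw [Set.not_infinite] at hc
      obtain ⟨B, hB⟩ := hc.bddAbove
      refine ⟨0, B + 1, fun n hn h => ?_⟩
      have := hB h
      omega
  choose N n₀ h using key
  refine ⟨Finset.univ.sup N, Finset.univ.sup n₀, fun n hn => ?_⟩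
  obtain ⟨S, hS, hm⟩ := h (τ n) n ((Finset.le_sup (Finset.mem_univ _)).trans hn) rfl
  exact ⟨S, hS, fun m hmS =>
    ⟨(hm m hmS).1.trans (Finset.le_sup (Finset.mem_univ _)), (hm m hmS).2⟩⟩

/-- Powers of two integers greater than `1` can be made relatively close. -/
theorem exists_close_powers {p q : ℕ} (hp : 1 < p) (hq : 1 < q) (K : ℕ) :
    ∃ A b r : ℕ, 0 < b ∧ (q ^ b = p ^ A + r ∨ p ^ A = q ^ b + r) ∧ K * r ≤ p ^ A := by
  have hlp : 0 < Real.log p := Real.log_pos (by exact_mod_cast hp)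
  have hlq : 0 < Real.log q := Real.log_pos (by exact_mod_cast hq)
  obtain ⟨m, hm⟩ := exists_nat_gt (2 * (K + 1) * Real.log p)
  have hK : (0 : ℝ) ≤ K := K.cast_nonneg
  have hm0 : (0 : ℝ) < m := lt_of_le_of_lt (by positivity) hm
  -- Dirichlet approximation of `log q / log p`; the size of `m` makes `|k log q - j log p|` at most
  -- `1 / (2 (K + 1))`.
  obtain ⟨j, k, hk, -, hjk⟩ :=
    Real.exists_int_int_abs_mul_sub_le (Real.log q / Real.log p) (by exact_mod_cast hm0 : 0 < m)
  have hd : |k * Real.log q - j * Real.log p| ≤ Real.log p / (m + 1) := by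
    have : k * Real.log q - j * Real.log p = (k * (Real.log q / Real.log p) - j) * Real.log p := by
      field_simp
    rw [this, abs_mul, abs_of_pos hlp]
    calc _ ≤ 1 / ((m : ℝ) + 1) * Real.log p := by gcongr
      _ = _ := by ring
  have hη : Real.log p / (m + 1) ≤ 1 / (2 * (K + 1)) := by
    rw [div_le_div_iff₀ (by positivity) (by positivity)]
    linarith
  set η := k * Real.log q - j * Real.log p with hηdef
  have hη1 : |η| ≤ 1 / (2 * (K + 1)) := hd.trans hη
  have hηle : |η| ≤ 1 := hη1.trans (by rw [div_le_one (by positivity)]; linarith)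
  have hj : 0 ≤ j := by
    by_contra! hj
    have h1 : (j : ℝ) ≤ -1 := by exact_mod_cast (by omega : j ≤ -1)
    have h2 : (1 : ℝ) ≤ k := by exact_mod_cast hk
    have h3 : Real.log p / (m + 1) < Real.log p := by
      rw [div_lt_iff₀ (by positivity)]
      nlinarith
    have := le_abs_self η
    nlinarith
  lift j to ℕ using hj
  lift k to ℕ using hk.le
  have hpA : (0 : ℝ) < (p : ℝ) ^ j := by positivity
  have hexp : (q : ℝ) ^ k = (p : ℝ) ^ j * Real.exp η := by
    rw [hηdef, Real.exp_sub, mul_comm (((k : ℤ) : ℝ)), mul_comm (((j : ℤ) : ℝ))]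
    simp only [Int.cast_natCast]
    rw [← Real.rpow_def_of_pos (by positivity), ← Real.rpow_def_of_pos (by positivity),
      Real.rpow_natCast, Real.rpow_natCast]
    field_simp
  have hexp1 : |Real.exp η - 1| ≤ 1 / (K + 1) := by
    refine (Real.abs_exp_sub_one_le hηle).trans ?_
    calc 2 * |η| ≤ 2 * (1 / (2 * (K + 1))) := by gcongr
      _ = 1 / (K + 1) := by field_simp
  have hclose : K * |(q : ℝ) ^ k - (p : ℝ) ^ j| ≤ (p : ℝ) ^ j := by
    have : (q : ℝ) ^ k - (p : ℝ) ^ j = (p : ℝ) ^ j * (Real.exp η - 1) := by rw [hexp]; ring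
    rw [this, abs_mul, abs_of_pos hpA]
    calc K * ((p : ℝ) ^ j * |Real.exp η - 1|) ≤ (K + 1) * ((p : ℝ) ^ j * (1 / (K + 1))) := by
          gcongr
          linarith
      _ = (p : ℝ) ^ j := by field_simp
  have hk' : 0 < k := by exact_mod_cast hk
  rcases le_total (p ^ j) (q ^ k) with hle | hle
  · obtain ⟨r, hr⟩ := Nat.exists_eq_add_of_le hle
    refine ⟨j, k, r, hk', Or.inl hr, ?_⟩
    have hr' : (q : ℝ) ^ k - (p : ℝ) ^ j = r := by
      rw [sub_eq_iff_eq_add']; exact_mod_cast hr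
    rw [hr', Nat.abs_cast] at hclose
    exact_mod_cast hclose
  · obtain ⟨r, hr⟩ := Nat.exists_eq_add_of_le hle
    refine ⟨j, k, r, hk', Or.inr hr, ?_⟩
    have hr' : (q : ℝ) ^ k - (p : ℝ) ^ j = -r := by
      rw [sub_eq_iff_eq_add', ← sub_eq_add_neg, eq_sub_iff_add_eq]; exact_mod_cast hr.symm
    rw [hr', abs_neg, Nat.abs_cast] at hclose
    exact_mod_cast hclose

/-- A sequence with a long period `P` on an interval inherits there the period of a pair of equal
columns modulo some `q` prime to `P`. -/
theorem period_of_equalColumns {f : ℕ → V} {Q P q h : ℕ} (hq : 0 < q)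
    (hP : ∀ j, Q ≤ j → 2 * j ≤ 5 * Q → f j = f (j + P)) (hcop : P.Coprime q)
    (hf : HasEqualColumns f q h) (hQ : 2 * (q * P + h) ≤ Q) (j : ℕ) (hj : Q ≤ j)
    (hj' : j < 2 * Q) : f j = f (j + h) := by
  obtain ⟨d, hd⟩ := hf
  -- The bound `hQ` keeps `i + t * P` within `5 * Q / 2` for `t ≤ q`. The point `j` is moved by
  -- multiples of `P` into the column `d`, then by `h`, then back.
  have steps : ∀ t i, t ≤ q → Q ≤ i → i ≤ j + h → f i = f (i + t * P) := by
    intro t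
    induction t with
    | zero => simp
    | succ t ih =>
      intro i ht hi hij
      have h1 : t * P ≤ q * P := Nat.mul_le_mul_right _ (by omega)
      rw [ih i (by omega) hi hij, hP (i + t * P) (by omega) (by omega)]
      congr 1
      ring
  obtain ⟨t, ht, hmod⟩ : ∃ t < q, j + t * P ≡ d [MOD q] := by
    have : NeZero q := ⟨hq.ne'⟩
    refine ⟨(((d : ZMod q) - j) * (P : ZMod q)⁻¹).val, ZMod.val_lt _, ?_⟩
    rw [← ZMod.natCast_eq_natCast_iff]
    push_cast
    rw [ZMod.natCast_zmod_val, mul_assoc, mul_comm _ (P : ZMod q),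
      ZMod.coe_mul_inv_eq_one _ hcop]
    ring
  rw [steps t j ht.le hj (by omega), hd _ hmod, steps t (j + h) ht.le (by omega) le_rfl]
  congr 1
  ring

theorem HasEqualColumns.shift {a : ℕ → V} {q h : ℕ} (hq : 0 < q) (ha : HasEqualColumns a q h)
    (c : ℕ) : HasEqualColumns (fun j => a (c + j)) q h := by
  obtain ⟨d, hd⟩ := ha
  -- This is `d - c` modulo `q`, without subtraction.
  refine ⟨d + (q - 1) * c, fun n hn => ?_⟩
  simp only [← add_assoc]
  refine hd _ ?_
  have h1 : c + n ≡ c + (d + (q - 1) * c) [MOD q] := hn.add_left c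
  have h2 : c + (d + (q - 1) * c) = d + q * c := by
    obtain ⟨s, rfl⟩ := Nat.exists_eq_add_of_lt hq
    simp
    ring
  rw [h2] at h1
  exact h1.trans (by simp [Nat.ModEq])

/-- Fix a base `p`, then a base `q` prime to everything in sight, with `Q = p ^ A` and `q ^ b` at
distance `r`. The window at `Q * n` recurs at `Q * m` and `Q * m'` for small `m < m'` with the same
`q`-classes, so the windows at `q ^ b * m` and `q ^ b * m'` agree too. The offsets `r * m` and `r *
m'` differ, which yields the local period `r * (m' - m)`. It is prime to `q`, and the equal columns
turn it into `h`, which does not depend on `n`. -/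
theorem eventuallyPeriodic_of_forwardClasses {a : ℕ → V} {C : ℕ}
    (H : ∀ N, ∃ q, 1 < q ∧ (∀ m, 0 < m → m ≤ N → m.Coprime q) ∧ HasForwardClasses a q C ∧
      ∃ h, 0 < h ∧ HasEqualColumns a q h) : EventuallyPeriodic a := by
  obtain ⟨p, hp1, -, ⟨σ, hσ⟩, -⟩ := H 0
  obtain ⟨N, n₀, hN⟩ :=
    exists_representatives (fun n => (σ n, σ (n + 1), σ (n + 2))) (C * (C * C))
  obtain ⟨q, hq1, hcop, ⟨ρ, hρ⟩, h, hh, hcol⟩ := H (max N p)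
  have hpq : p.Coprime q := hcop p (by omega) (le_max_right _ _)
  -- The constant makes `r * N`, `q * r * N` and `h` small against `p ^ A`, as `hbig` requires.
  obtain ⟨A, b, r, hb, hr, hK⟩ := exists_close_powers hp1 hq1 (8 * q * (N + 1) + 2 * h)
  have hcopP : (p ^ A).Coprime q := hpq.pow_left A
  have hrq : r.Coprime q := by
    rcases hr with hr | hr
    · have : r.gcd q ∣ p ^ A := by
        refine (Nat.dvd_add_left (Nat.gcd_dvd_left r q)).1 ?_
        rw [← hr]
        exact (Nat.gcd_dvd_right r q).trans (dvd_pow_self q hb.ne')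
      exact Nat.eq_one_of_dvd_coprimes hcopP this (Nat.gcd_dvd_right r q)
    · have : r.gcd q ∣ p ^ A := by
        rw [hr]
        exact dvd_add ((Nat.gcd_dvd_right r q).trans (dvd_pow_self q hb.ne'))
          (Nat.gcd_dvd_left r q)
      exact Nat.eq_one_of_dvd_coprimes hcopP this (Nat.gcd_dvd_right r q)
  have hr0 : 0 < r := by
    rcases Nat.eq_zero_or_pos r with rfl | h0
    · simp at hrq
      omega
    · exact h0
  refine ⟨p ^ A * (n₀ + 1), h, hh, fun x hx => ?_⟩
  have hpA : 0 < p ^ A := by positivity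
  -- The point `x` is put in the middle block of the window of length `3 * p ^ A` at `p ^ A * n`.
  obtain ⟨n, e, he, hn, rfl⟩ : ∃ n e, e < p ^ A ∧ n₀ ≤ n ∧ x = p ^ A * n + (p ^ A + e) := by
    have h1 : n₀ + 1 ≤ x / p ^ A := by
      rw [Nat.le_div_iff_mul_le hpA, mul_comm]
      exact hx
    obtain ⟨n, hn⟩ := Nat.exists_eq_add_of_le h1
    refine ⟨n₀ + n, x % p ^ A, Nat.mod_lt _ hpA, by omega, ?_⟩
    conv_lhs => rw [← Nat.div_add_mod x (p ^ A), hn]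
    ring
  obtain ⟨S, hcard, hS⟩ := hN n hn
  obtain ⟨m, hm, m', hm', hne, hρm⟩ := Finset.exists_ne_map_eq_of_card_lt_of_maps_to
    (s := S) (t := Finset.univ) (f := fun n => (ρ n, ρ (n + 1), ρ (n + 2)))
    (by simpa using hcard) (fun _ _ => Finset.mem_coe.2 (Finset.mem_univ _))
  wlog hlt : m < m' generalizing m m'
  · exact this m' hm' m hm hne.symm hρm.symm (by omega)
  obtain ⟨l, rfl⟩ := Nat.exists_eq_add_of_lt hlt
  set Q := p ^ A with hQ
  have hmN := (hS _ hm').1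
  have hτ : ∀ j, j < 3 * Q → a (Q * n + j) = a (Q * m + j) := fun j hj =>
    triple_blocks_eq hσ (hS _ hm).2.symm A j hj
  have hτ' : ∀ j, j < 3 * Q → a (Q * n + j) = a (Q * (m + l + 1) + j) := fun j hj =>
    triple_blocks_eq hσ (hS _ hm').2.symm A j hj
  have hρ' : ∀ j, j < 3 * q ^ b → a (q ^ b * m + j) = a (q ^ b * (m + l + 1) + j) := fun j hj =>
    triple_blocks_eq hρ hρm b j hj
  have hbig : 16 * (r * N) ≤ Q ∧ 2 * (q * (r * N) + h) ≤ Q := by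
    constructor <;> refine le_trans ?_ hK <;>
      nlinarith [Nat.zero_le (q * r * N), Nat.mul_le_mul_right (r * N) hq1.le,
        Nat.mul_le_mul_left h hr0, Nat.zero_le (q * r), Nat.zero_le (h * r)]
  have hrm : r * m + r * (l + 1) ≤ r * N := by
    rw [← mul_add]
    exact Nat.mul_le_mul_left _ (by omega)
  rw [add_assoc]
  refine (period_of_equalColumns (f := fun j => a (Q * n + j)) (Q := Q) (P := r * (l + 1))
    (by omega) ?_ ?_ (hcol.shift (by omega) (Q * n)) ?_ (Q + e) (by omega) (by omega)).symm
  · intro j hj hj'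
    rcases hr with hr | hr
    · obtain ⟨i, rfl⟩ := Nat.exists_eq_add_of_le (show r * m ≤ j by omega)
      have h1 : Q * m + (r * m + i) = q ^ b * m + i := by rw [hr]; ring
      have h2 : Q * (m + l + 1) + (r * m + i + r * (l + 1)) = q ^ b * (m + l + 1) + i := by
        rw [hr]; ring
      rw [hτ _ (by omega), hτ' _ (by omega), h1, h2, hρ' _ (by omega)]
    -- Here `q ^ b < Q`, so the offsets change sign and `m`, `m'` exchange roles.
    · have h1 : Q * m + (j + r * (l + 1)) = q ^ b * m + (j + r * (l + 1) + r * m) := by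
        rw [hr]; ring
      have h2 : Q * (m + l + 1) + j = q ^ b * (m + l + 1) + (j + r * (l + 1) + r * m) := by
        rw [hr]; ring
      have : r ≤ r * (l + 1) := Nat.le_mul_of_pos_right _ (by omega)
      rw [hτ' _ (by omega), hτ _ (by omega), h1, h2, hρ' _ (by omega)]
  · exact Nat.Coprime.mul_left hrq (hcop _ (by omega) (le_trans (by omega) (le_max_left _ _)))
  · refine le_trans ?_ hbig.2
    gcongr
    omega

end PeriodicityCriterion

/-! ### Rational series and eventual periodicity. -/

section RationalSeries

variable {K : Type*} [Field K]

theorem coeff_coe_mul_X_pow_sub_one (a : ℕ → K) (m n : ℕ) :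
    PowerSeries.coeff (n + m) (PowerSeries.mk a * (PowerSeries.X ^ m - 1)) = a n - a (n + m) := by
  rw [mul_sub, mul_one, map_sub, PowerSeries.coeff_mul_X_pow]
  simp

/-- A polynomial over an algebraically closed field whose roots are simple and are roots of unity
divides some `X ^ m - 1`. -/
theorem exists_dvd_X_pow_sub_one {F : Type*} [Field F] [CharZero F] [IsAlgClosed F]
    {d : Polynomial F} (hd : d ≠ 0)
    (h : ∀ z, 0 < d.rootMultiplicity z → d.rootMultiplicity z = 1 ∧ ∃ n : ℕ, 0 < n ∧ z ^ n = 1) :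
    ∃ m : ℕ, 0 < m ∧ d ∣ Polynomial.X ^ m - 1 := by
  classical
  have hroot : ∀ z ∈ d.roots.toFinset, ∃ n : ℕ, 0 < n ∧ z ^ n = 1 := fun z hz => by
    rw [Multiset.mem_toFinset, Polynomial.mem_roots hd] at hz
    exact (h z ((Polynomial.rootMultiplicity_pos hd).2 hz)).2
  choose! n hn hz using hroot
  have hm : 0 < ∏ z ∈ d.roots.toFinset, n z := Finset.prod_pos hn
  refine ⟨_, hm, ?_⟩
  -- The exponent is a common multiple of exponents that kill the individual roots.
  have hne : (Polynomial.X ^ (∏ z ∈ d.roots.toFinset, n z) - 1 : Polynomial F) ≠ 0 :=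
    Polynomial.X_pow_sub_C_ne_zero hm 1
  rw [IsAlgClosed.dvd_iff_roots_le_roots hd hne, Multiset.le_iff_subset]
  · intro z hzd
    have hzd' := Multiset.mem_toFinset.2 hzd
    obtain ⟨c, hc⟩ := Finset.dvd_prod_of_mem n hzd'
    rw [Polynomial.mem_roots hne, Polynomial.IsRoot.def, hc]
    simp [pow_mul, hz z hzd']
  · rw [Multiset.nodup_iff_count_le_one]
    intro z
    rw [Polynomial.count_roots]
    rcases Nat.eq_zero_or_pos (d.rootMultiplicity z) with h0 | h0
    · omega
    · exact (h z h0).1.le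

theorem EventuallyPeriodic.of_isRational [CharZero K] {a : ℕ → K}
    (h : IsRationalWithSimplePolesAtRootsOfUnity (PowerSeries.mk a)) : EventuallyPeriodic a := by
  obtain ⟨r, hr, hpole⟩ := h
  have hd : r.denom ≠ 0 := r.denom_ne_zero
  obtain ⟨m, hm, hdvd⟩ := exists_dvd_X_pow_sub_one
    ((Polynomial.map_ne_zero_iff (algebraMap K (AlgebraicClosure K)).injective).2 hd) hpole
  have hdvd' : r.denom ∣ Polynomial.X ^ m - 1 := by
    rw [← Polynomial.map_dvd_map' (algebraMap K (AlgebraicClosure K))]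
    simpa using hdvd
  obtain ⟨c, hc⟩ := hdvd'
  have hprod : PowerSeries.mk a * (PowerSeries.X ^ m - 1) =
      ((r.num * c : Polynomial K) : PowerSeries K) := by
    apply HahnSeries.ofPowerSeries_injective (Γ := ℤ)
    have h1 : (PowerSeries.X ^ m - 1 : PowerSeries K) =
        ((Polynomial.X ^ m - 1 : Polynomial K) : PowerSeries K) := by simp
    rw [h1, PowerSeries.coe_mul, ← hr, hc, RatFunc.coe_coe, RatFunc.coe_coe, ← map_mul]
    congr 1
    have hd' : algebraMap (Polynomial K) (RatFunc K) r.denom ≠ 0 := RatFunc.algebraMap_ne_zero hd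
    have hnum : r * algebraMap (Polynomial K) (RatFunc K) r.denom = algebraMap _ _ r.num := by
      rw [← eq_div_iff hd', RatFunc.num_div_denom]
    change r * algebraMap (Polynomial K) (RatFunc K) (r.denom * c) = algebraMap _ _ (r.num * c)
    rw [map_mul, map_mul, ← mul_assoc, hnum]
  refine ⟨(r.num * c).natDegree + 1, m, hm, fun n hn => ?_⟩
  have hcoeff := coeff_coe_mul_X_pow_sub_one a m n
  rw [hprod, Polynomial.coeff_coe, Polynomial.coeff_eq_zero_of_natDegree_lt (by omega)] at hcoeff
  exact (sub_eq_zero.1 hcoeff.symm).symm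

theorem EventuallyPeriodic.isRational [CharZero K] {a : ℕ → K} (h : EventuallyPeriodic a) :
    IsRationalWithSimplePolesAtRootsOfUnity (PowerSeries.mk a) := by
  obtain ⟨n₀, m, hm, ha⟩ := h
  have hne : (Polynomial.X ^ m - 1 : Polynomial K) ≠ 0 := Polynomial.X_pow_sub_C_ne_zero hm 1
  set s := PowerSeries.mk a * (PowerSeries.X ^ m - 1) with hs
  have htrunc : ((s.trunc (n₀ + m) : Polynomial K) : PowerSeries K) = s := by
    ext n
    rw [Polynomial.coeff_coe, PowerSeries.coeff_trunc]
    split_ifs with hn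
    · rfl
    · obtain ⟨k, rfl⟩ := Nat.exists_eq_add_of_le (not_lt.1 hn)
      rw [hs, show n₀ + m + k = n₀ + k + m by ring, coeff_coe_mul_X_pow_sub_one,
        ha _ (Nat.le_add_right _ _), sub_self]
  refine ⟨algebraMap _ _ (s.trunc (n₀ + m)) /
    algebraMap (Polynomial K) _ (Polynomial.X ^ m - 1), ?_, ?_⟩
  · have hcoe : ∀ P : Polynomial K,
        ((algebraMap (Polynomial K) (RatFunc K) P : RatFunc K) : K⸨X⸩) = ((P : PowerSeries K) : K⸨X⸩) := fun P => (RatFunc.coe_coe P).symm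
    have h1 : ((Polynomial.X ^ m - 1 : Polynomial K) : PowerSeries K) =
        PowerSeries.X ^ m - 1 := by simp
    rw [map_div₀, hcoe, hcoe, htrunc, hs, PowerSeries.coe_mul, h1, mul_div_cancel_right₀]
    rw [← h1, ← hcoe, Ne, map_eq_zero]
    exact RatFunc.algebraMap_ne_zero hne
  · intro z hz
    set d := RatFunc.denom (algebraMap _ _ (s.trunc (n₀ + m)) /
      algebraMap (Polynomial K) (RatFunc K) (Polynomial.X ^ m - 1)) with hd
    have hdvd := RatFunc.denom_div_dvd (s.trunc (n₀ + m)) (Polynomial.X ^ m - 1)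
    rw [← hd, ← Polynomial.map_dvd_map' (algebraMap K (AlgebraicClosure K))] at hdvd
    simp only [Polynomial.map_sub, Polynomial.map_pow, Polynomial.map_X, Polynomial.map_one]
      at hdvd
    have hne' : (Polynomial.X ^ m - 1 : Polynomial (AlgebraicClosure K)) ≠ 0 :=
      Polynomial.X_pow_sub_C_ne_zero hm 1
    have hle := Polynomial.rootMultiplicity_le_rootMultiplicity_of_dvd hne' hdvd z
    have hsep : (Polynomial.X ^ m - 1 : Polynomial (AlgebraicClosure K)).Separable :=
      Polynomial.X_pow_sub_one_separable_iff.2 (by exact_mod_cast hm.ne')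
    have h1 := Polynomial.rootMultiplicity_le_one_of_separable hsep z
    change 0 < (d.map _).rootMultiplicity z at hz
    refine ⟨le_antisymm (hle.trans h1) hz, m, hm, ?_⟩
    have hroot := (Polynomial.rootMultiplicity_pos hne').1 (hz.trans_le hle)
    simpa [sub_eq_zero] using hroot

end RationalSeries

/-! ### Primes of `K`, residue fields and reduction. -/

section Places

variable {K : Type*} [Field K] [NumberField K]

theorem finite_setOf_valuation_ne_one {x : K} (hx : x ≠ 0) :
    {𝔭 : HeightOneSpectrum (𝓞 K) | 𝔭.valuation K x ≠ 1}.Finite := by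
  refine ((HeightOneSpectrum.Support.finite (𝓞 K) x).union
    (HeightOneSpectrum.Support.finite (𝓞 K) x⁻¹)).subset fun 𝔭 h𝔭 => ?_
  rcases lt_or_gt_of_ne h𝔭 with h | h
  · right
    change 1 < 𝔭.valuation K x⁻¹
    rw [map_inv₀]
    exact (one_lt_inv₀ (zero_lt_iff.2 ((Valuation.ne_zero_iff _).2 hx))).2 h
  · exact Or.inl h

theorem exists_mem_forall_valuation_eq_one {T : Set (HeightOneSpectrum (𝓞 K))} (hT : T.Infinite)
    {F : Set K} (hF : F.Finite) (h0 : ∀ x ∈ F, x ≠ 0) :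
    ∃ 𝔭 ∈ T, ∀ x ∈ F, 𝔭.valuation K x = 1 := by
  have hfin : (⋃ x ∈ F, {𝔭 : HeightOneSpectrum (𝓞 K) | 𝔭.valuation K x ≠ 1}).Finite :=
    hF.biUnion fun x hx => finite_setOf_valuation_ne_one (h0 x hx)
  obtain ⟨𝔭, h𝔭, hn⟩ := hT.exists_notMem_finite hfin
  refine ⟨𝔭, h𝔭, fun x hx => ?_⟩
  by_contra h
  exact hn (Set.mem_biUnion hx h)

theorem residue_ne_zero {𝔭 : HeightOneSpectrum (𝓞 K)} {x : (𝔭.valuation K).valuationSubring}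
    (hx : 𝔭.valuation K x = 1) :
    IsLocalRing.residue (𝔭.valuation K).valuationSubring x ≠ 0 := by
  have hx0 : (x : K) ≠ 0 := by
    rw [← Valuation.ne_zero_iff (𝔭.valuation K), hx]
    exact one_ne_zero
  have hu : IsUnit x := by
    refine IsUnit.of_mul_eq_one ⟨(x : K)⁻¹, ?_⟩ (Subtype.ext (mul_inv_cancel₀ hx0))
    rw [Valuation.mem_valuationSubring_iff, map_inv₀, hx, inv_one]
  exact (hu.map _).ne_zero

/-- Elements of the valuation ring are approximated by integers of `K`, so the finite ring `𝓞 K ⧸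
𝔭.asIdeal` surjects onto the residue field. -/
instance finite_residueFieldAt (𝔭 : HeightOneSpectrum (𝓞 K)) : Finite (ResidueFieldAt K 𝔭) := by
  let φ : 𝓞 K →+* (𝔭.valuation K).valuationSubring :=
    (algebraMap (𝓞 K) K).codRestrict _ fun r => 𝔭.valuation_le_one r
  let ψ : 𝓞 K →+* ResidueFieldAt K 𝔭 := (IsLocalRing.residue _).comp φ
  have hψ : ∀ r ∈ 𝔭.asIdeal, ψ r = 0 := fun r hr => by
    change IsLocalRing.residue _ (φ r) = 0
    rw [IsLocalRing.residue_eq_zero_iff, IsLocalRing.mem_maximalIdeal, mem_nonunits_iff]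
    intro hu
    obtain ⟨s, hs⟩ := hu.exists_right_inv
    have h1 : 𝔭.valuation K (algebraMap (𝓞 K) K r) < 1 := (𝔭.valuation_lt_one_iff_mem r).2 hr
    have h2 : algebraMap (𝓞 K) K r * (s : K) = 1 := congrArg Subtype.val hs
    have h3 : 𝔭.valuation K (algebraMap (𝓞 K) K r) * 𝔭.valuation K (s : K) = 1 := by
      rw [← map_mul, h2, map_one]
    exact (mul_lt_one_of_lt_of_le h1 s.2).ne h3
  have : Finite (𝓞 K ⧸ 𝔭.asIdeal) := Ideal.finiteQuotientOfFreeOfNeBot _ 𝔭.ne_bot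
  refine Finite.of_surjective (Ideal.Quotient.lift 𝔭.asIdeal ψ hψ) fun z => ?_
  obtain ⟨x, rfl⟩ := IsLocalRing.residue_surjective z
  obtain ⟨r, hr⟩ := 𝔭.exists_valuation_sub_lt_of_integer x.2 1
  refine ⟨Ideal.Quotient.mk _ r, ?_⟩
  rw [Ideal.Quotient.lift_mk]
  change IsLocalRing.residue _ (φ r) = _
  rw [← sub_eq_zero, ← map_sub, IsLocalRing.residue_eq_zero_iff, IsLocalRing.mem_maximalIdeal,
    mem_nonunits_iff]
  intro hu
  obtain ⟨s, hs⟩ := hu.exists_right_inv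
  have h2 : (algebraMap (𝓞 K) K r - x) * (s : K) = 1 := congrArg Subtype.val hs
  have h3 : 𝔭.valuation K (algebraMap (𝓞 K) K r - x) * 𝔭.valuation K (s : K) = 1 := by
    rw [← map_mul, h2, map_one]
  exact (mul_lt_one_of_lt_of_le hr s.2).ne h3

theorem coprime_card_residueFieldAt {𝔭 : HeightOneSpectrum (𝓞 K)} {m : ℕ}
    (hm : 𝔭.valuation K (m : K) = 1) : m.Coprime (Nat.card (ResidueFieldAt K 𝔭)) := by
  cases nonempty_fintype (ResidueFieldAt K 𝔭)
  obtain ⟨p, hp⟩ := CharP.exists (ResidueFieldAt K 𝔭)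
  obtain ⟨n, hprime, hcard⟩ := FiniteField.card (ResidueFieldAt K 𝔭) p
  rw [Nat.card_eq_fintype_card, hcard]
  refine Nat.Coprime.pow_right _ ((Nat.Prime.coprime_iff_not_dvd hprime).2 fun hdvd => ?_).symm
  have h0 : ((m : ℕ) : ResidueFieldAt K 𝔭) = 0 := (CharP.cast_eq_zero_iff _ p m).2 hdvd
  refine residue_ne_zero (x := (m : (𝔭.valuation K).valuationSubring)) (by simpa using hm) ?_
  rw [map_natCast]
  exact h0

/-- Every rational prime lies in some `𝔭`, and no `𝔭` contains two of them. This makes a cofinite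
set of primes infinite. -/
instance infinite_heightOneSpectrum : Infinite (HeightOneSpectrum (𝓞 K)) := by
  have key : ∀ p : Nat.Primes, ∃ 𝔭 : HeightOneSpectrum (𝓞 K), ((p : ℕ) : 𝓞 K) ∈ 𝔭.asIdeal := by
    intro p
    have hne : Ideal.span {((p : ℕ) : 𝓞 K)} ≠ ⊤ := by
      rw [Ne, Ideal.span_singleton_eq_top]
      intro hu
      have := hu.map (Algebra.norm ℤ)
      rw [show ((p : ℕ) : 𝓞 K) = algebraMap ℤ (𝓞 K) (p : ℕ) by simp, Algebra.norm_algebraMap,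
        isUnit_pow_iff Module.finrank_pos.ne', Int.isUnit_iff_natAbs_eq] at this
      exact p.2.one_lt.ne' (by simpa using this)
    obtain ⟨M, hM, hle⟩ := Ideal.exists_le_maximal _ hne
    have hmem : ((p : ℕ) : 𝓞 K) ∈ M := hle (Ideal.mem_span_singleton_self _)
    refine ⟨⟨M, hM.isPrime, fun h => ?_⟩, hmem⟩
    rw [h, Ideal.mem_bot] at hmem
    exact p.2.ne_zero (by exact_mod_cast hmem)
  choose f hf using key
  refine Infinite.of_injective f fun p p' h => ?_
  by_contra hne
  have hcop : IsCoprime ((p : ℕ) : ℤ) ((p' : ℕ) : ℤ) :=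
    Nat.isCoprime_iff_coprime.2
      ((Nat.coprime_primes p.2 p'.2).2 fun h => hne (Subtype.ext h))
  obtain ⟨u, v, huv⟩ := hcop
  refine (f p).isPrime.ne_top ((Ideal.eq_top_iff_one _).2 ?_)
  have h1 : (u : 𝓞 K) * ((p : ℕ) : 𝓞 K) + (v : 𝓞 K) * ((p' : ℕ) : 𝓞 K) = 1 := by
    exact_mod_cast congrArg (Int.cast : ℤ → 𝓞 K) huv
  rw [← h1]
  exact Ideal.add_mem _ (Ideal.mul_mem_left _ _ (hf p)) (Ideal.mul_mem_left _ _ (h ▸ hf p'))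

theorem EventuallyPeriodic.finite_range {V : Type*} {a : ℕ → V} (h : EventuallyPeriodic a) :
    (Set.range a).Finite := by
  obtain ⟨n₀, m, hm, ha⟩ := h
  refine ((Set.finite_lt_nat (n₀ + m)).image a).subset ?_
  rintro _ ⟨n, rfl⟩
  induction n using Nat.strong_induction_on with
  | _ n ih =>
    rcases lt_or_ge n (n₀ + m) with hn | hn
    · exact ⟨n, hn, rfl⟩
    · obtain ⟨k, rfl⟩ := Nat.exists_eq_add_of_le hn
      have := ha (n₀ + k) (by omega)
      rw [show n₀ + m + k = n₀ + k + m by ring, this]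
      exact ih _ (by omega)

theorem finite_setOf_not_integralAt {a : ℕ → K} (h : (Set.range a).Finite) :
    {𝔭 : HeightOneSpectrum (𝓞 K) | ¬ IntegralAt a 𝔭}.Finite := by
  refine (h.biUnion fun x _ => HeightOneSpectrum.Support.finite (𝓞 K) x).subset fun 𝔭 h𝔭 => ?_
  simp only [IntegralAt, Set.mem_ofPred_eq, not_forall, not_le] at h𝔭
  obtain ⟨n, hn⟩ := h𝔭
  exact Set.mem_biUnion ⟨n, rfl⟩ hn

theorem reduceAt_eq_iff {a : ℕ → K} {𝔭 : HeightOneSpectrum (𝓞 K)} (h : IntegralAt a 𝔭) {i j : ℕ}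
    (hij : a i ≠ a j → 𝔭.valuation K (a i - a j) = 1) :
    reduceAt a 𝔭 h i = reduceAt a 𝔭 h j ↔ a i = a j := by
  constructor
  · intro heq
    by_contra hne
    rw [reduceAt, reduceAt, ← sub_eq_zero, ← map_sub] at heq
    exact residue_ne_zero (by simpa using hij hne) heq
  · intro heq
    simp only [reduceAt, heq]

end Places

/-! ### Base-`q` expansions. -/

section Words

/-- In `baseValue` the coercion to `ℕ` is applied to the whole list, through the list monad; here it
is applied digit by digit. -/
theorem baseValue_eq_foldl (q : ℕ) (w : List (Fin q)) :
    baseValue q w = w.foldl (fun n (d : Fin q) => q * n + (d : ℕ)) 0 := by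
  have : (do let d ← w; pure (d : ℕ)) = w.map (fun d : Fin q => (d : ℕ)) :=
    List.flatMap_pure_eq_map _ w
  rw [baseValue, this, List.foldl_map]

theorem foldl_eq_baseValue (q s : ℕ) (w : List (Fin q)) :
    w.foldl (fun n (d : Fin q) => q * n + (d : ℕ)) s = q ^ w.length * s + baseValue q w := by
  rw [baseValue_eq_foldl]
  induction w generalizing s with
  | nil => simp
  | cons d w ih =>
    rw [List.foldl_cons, List.foldl_cons, List.length_cons, ih, ih (q * 0 + d)]
    ring

theorem baseValue_append (q : ℕ) (u w : List (Fin q)) :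
    baseValue q (u ++ w) = q ^ w.length * baseValue q u + baseValue q w := by
  rw [baseValue_eq_foldl, List.foldl_append, foldl_eq_baseValue, ← baseValue_eq_foldl]

theorem baseValue_append_singleton (q : ℕ) (u : List (Fin q)) (d : Fin q) :
    baseValue q (u ++ [d]) = q * baseValue q u + d := by
  simp [baseValue_eq_foldl]

theorem exists_baseValue_eq {q : ℕ} (hq : 0 < q) (k i : ℕ) (hi : i < q ^ k) :
    ∃ w : List (Fin q), w.length = k ∧ baseValue q w = i := by
  induction k generalizing i with
  | zero =>
    refine ⟨[], rfl, ?_⟩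
    simp at hi
    simp [baseValue, hi]
  | succ k ih =>
    obtain ⟨w, hw, hv⟩ := ih (i / q) (Nat.div_lt_of_lt_mul (by rwa [pow_succ'] at hi))
    refine ⟨w ++ [⟨i % q, Nat.mod_lt _ hq⟩], by simp [hw], ?_⟩
    rw [baseValue_append_singleton, hv]
    exact Nat.div_add_mod i q

theorem exists_baseValue {q : ℕ} (hq : 1 < q) (n : ℕ) : ∃ w : List (Fin q), baseValue q w = n :=
  (exists_baseValue_eq (by omega) n n (Nat.lt_pow_self hq)).imp fun _ h => h.2

end Words

/-! ### What automata say about a sequence, and automata from semirings. -/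

section Complexity

variable {Del : Type*} {q : ℕ} {a : ℕ → Del}

theorem exists_generatesForward {C : ℕ} (h : forwardComplexity q a ≤ C) :
    ∃ m ≤ C, ∃ M : DFAO (Fin q) Del (Fin m), GeneratesForward M a := by
  have hne : {N : ℕ∞ | ∃ m : ℕ, N = m ∧ ∃ M : DFAO (Fin q) Del (Fin m),
      GeneratesForward M a}.Nonempty := by
    by_contra hne
    rw [forwardComplexity, Set.not_nonempty_iff_eq_empty.1 hne, sInf_empty] at h
    exact absurd h (by simp)
  obtain ⟨m, hm, hM⟩ := csInf_mem hne
  refine ⟨m, ?_, hM⟩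
  rw [forwardComplexity, hm] at h
  exact_mod_cast h

theorem exists_generatesReverse {C : ℕ} (h : reverseComplexity q a ≤ C) :
    ∃ m ≤ C, ∃ M : DFAO (Fin q) Del (Fin m), GeneratesReverse M a := by
  have hne : {N : ℕ∞ | ∃ m : ℕ, N = m ∧ ∃ M : DFAO (Fin q) Del (Fin m),
      GeneratesReverse M a}.Nonempty := by
    by_contra hne
    rw [reverseComplexity, Set.not_nonempty_iff_eq_empty.1 hne, sInf_empty] at h
    exact absurd h (by simp)
  obtain ⟨m, hm, hM⟩ := csInf_mem hne
  refine ⟨m, ?_, hM⟩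
  rw [reverseComplexity, hm] at h
  exact_mod_cast h

/-- The class of `n` is the state reached on an expansion of `n`; appending the words of length `k`
then reads off the block. -/
theorem hasForwardClasses_of_forwardComplexity_le {C : ℕ} (hq : 1 < q)
    (h : forwardComplexity q a ≤ C) : HasForwardClasses a q C := by
  obtain ⟨m, hm, M, hM⟩ := exists_generatesForward h
  choose w hw using exists_baseValue hq
  refine ⟨fun n => Fin.castLE hm (M.run (w n)), fun n n' hn k i hi => ?_⟩
  obtain ⟨u, hu, rfl⟩ := exists_baseValue_eq (by omega) k i hi
  have key : ∀ n, a (q ^ k * n + baseValue q u) = M.out (u.foldl M.step (M.run (w n))) := by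
    intro n
    have := hM (w n ++ u)
    rw [baseValue_append, hu, hw] at this
    rw [← this, DFAO.forwardFun, DFAO.run, List.foldl_append]
    rfl
  rw [key, key, Fin.castLE_injective hm hn]

/-- A reverse-reading automaton with at most `C` states sorts the residue classes modulo `q` into
at most `C` sets of classes that carry the same subsequence. -/
theorem exists_columns_of_reverseComplexity_le {C : ℕ} (hq : 1 < q)
    (h : reverseComplexity q a ≤ C) :
    ∃ (t : Fin q → Fin C) (g : Fin C → ℕ → Del), ∀ n (d : Fin q), a (q * n + (d : ℕ)) = g (t d) n := by
  obtain ⟨m, hm, M, hM⟩ := exists_generatesReverse h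
  choose w hw using exists_baseValue hq
  let t : Fin q → Fin C := fun d => Fin.castLE hm (M.step M.start d)
  have key : ∀ n (d : Fin q),
      a (q * n + d) = M.out ((w n).reverse.foldl M.step (M.step M.start d)) := by
    intro n d
    have := hM (w n ++ [d])
    rw [baseValue_append_singleton, hw] at this
    rw [← this, DFAO.reverseFun, DFAO.run, List.reverse_append]
    rfl
  have hC : ∀ d d' : Fin q, t d = t d' → ∀ n, a (q * n + d) = a (q * n + d') := by
    intro d d' hd n
    rw [key, key, Fin.castLE_injective hm hd]
  classical
  -- The value `a 0` is a dummy for classes that contain no digit.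
  refine ⟨t, fun c n => if hc : ∃ d, t d = c then a (q * n + (hc.choose : Fin q))
    else a 0, fun n d => ?_⟩
  have hd : ∃ d', t d' = t d := ⟨d, rfl⟩
  simp only [dif_pos hd]
  exact hC _ _ hd.choose_spec.symm n

theorem exists_hasEqualColumns {C : ℕ} (hq : 1 < q) (hC : C < q)
    (h : reverseComplexity q a ≤ C) : ∃ h, 0 < h ∧ HasEqualColumns a q h := by
  obtain ⟨t, g, ht⟩ := exists_columns_of_reverseComplexity_le hq h
  obtain ⟨d, d', hne, hd⟩ := Fintype.exists_ne_map_eq_of_card_lt t (by simpa using hC)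
  wlog hlt : d < d' generalizing d d'
  · exact this d' d hne.symm hd.symm (lt_of_le_of_ne (not_lt.1 hlt) hne.symm)
  refine ⟨d' - d, Nat.sub_pos_of_lt hlt, d, fun n hn => ?_⟩
  have hn' : n % q = d := Eq.trans hn (Nat.mod_eq_of_lt d.2)
  have h1 : n = q * (n / q) + d := by rw [← hn', Nat.div_add_mod]
  have h2 : n + (d' - d) = q * (n / q) + d' := by
    have : (d : ℕ) < d' := hlt
    omega
  rw [h2, ht]
  conv_lhs => rw [h1, ht, hd]

/-- The first `q` terms are the initial entries of the columns, hence take at most `C` values. -/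
theorem exists_ne_eq_of_reverseComplexity_le {C : ℕ} (hq : 1 < q)
    (h : reverseComplexity q a ≤ C) {S : Finset ℕ} (hS : C < S.card) (hSq : ∀ i ∈ S, i < q) :
    ∃ i ∈ S, ∃ j ∈ S, i ≠ j ∧ a i = a j := by
  obtain ⟨t, g, ht⟩ := exists_columns_of_reverseComplexity_le hq h
  have hlt : Fintype.card (Fin C) < Fintype.card S := by simpa using hS
  obtain ⟨i, j, hne, hij⟩ := Fintype.exists_ne_map_eq_of_card_lt
    (fun i : S => t ⟨i, hSq i i.2⟩) hlt
  refine ⟨i, i.2, j, j.2, fun h => hne (Subtype.ext h), ?_⟩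
  have h1 := ht 0 ⟨i, hSq i i.2⟩
  have h2 := ht 0 ⟨j, hSq j j.2⟩
  simp only [mul_zero, zero_add] at h1 h2
  rw [h1, h2]
  exact congrArg (fun c => g c 0) hij

/-- The automaton obtained by transporting the set of states along an equivalence. -/
def DFAO.transport {Sig Q Q' : Type*} (M : DFAO Sig Del Q) (e : Q ≃ Q') : DFAO Sig Del Q' where
  start := e M.start
  step s d := e (M.step (e.symm s) d)
  out s := M.out (e.symm s)

theorem DFAO.out_run_transport {Sig Q Q' : Type*} (M : DFAO Sig Del Q) (e : Q ≃ Q')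
    (w : List Sig) : (M.transport e).out ((M.transport e).run w) = M.out (M.run w) := by
  have : (M.transport e).run w = e (M.run w) := by
    rw [DFAO.run, DFAO.run]
    exact List.foldl_hom e fun s d => by simp [DFAO.transport]
  rw [this]
  simp [DFAO.transport]

theorem forwardComplexity_le_card {Q : Type*} [Finite Q] {M : DFAO (Fin q) Del Q}
    (h : GeneratesForward M a) : forwardComplexity q a ≤ Nat.card Q :=
  sInf_le ⟨Nat.card Q, rfl, M.transport (Finite.equivFin Q), fun w => by
    rw [← h w, DFAO.forwardFun, DFAO.out_run_transport, DFAO.forwardFun]⟩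

theorem reverseComplexity_le_card {Q : Type*} [Finite Q] {M : DFAO (Fin q) Del Q}
    (h : GeneratesReverse M a) : reverseComplexity q a ≤ Nat.card Q :=
  sInf_le ⟨Nat.card Q, rfl, M.transport (Finite.equivFin Q), fun w => by
    rw [← h w, DFAO.reverseFun, DFAO.out_run_transport, DFAO.reverseFun]⟩

/-- The forward-reading automaton that evaluates base-`q` expansions in a semiring. -/
def evalForward (q : ℕ) (R : Type*) [CommSemiring R] (g : R → Del) : DFAO (Fin q) Del R where
  start := 0
  step s d := q * s + (d : ℕ)
  out := g

/-- The reverse-reading automaton that evaluates base-`q` expansions in a semiring; the second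
component of the state is the weight of the next digit. -/
def evalReverse (q : ℕ) (R : Type*) [CommSemiring R] (g : R → Del) :
    DFAO (Fin q) Del (R × R) where
  start := (0, 1)
  step s d := (s.1 + (d : ℕ) * s.2, q * s.2)
  out s := g s.1

theorem evalForward_run (q : ℕ) (R : Type*) [CommSemiring R] (g : R → Del) (w : List (Fin q)) :
    (evalForward q R g).run w = (baseValue q w : R) := by
  induction w using List.reverseRecOn with
  | nil => simp [DFAO.run, evalForward, baseValue]
  | append_singleton w d ih =>
    rw [baseValue_append_singleton, DFAO.run, List.foldl_append]
    change (evalForward q R g).step ((evalForward q R g).run w) d = _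
    rw [ih]
    simp [evalForward]

theorem evalReverse_run (q : ℕ) (R : Type*) [CommSemiring R] (g : R → Del) (w : List (Fin q)) :
    (evalReverse q R g).run w.reverse = ((baseValue q w : R), (q : R) ^ w.length) := by
  induction w with
  | nil => simp [DFAO.run, evalReverse, baseValue]
  | cons d w ih =>
    rw [List.reverse_cons, DFAO.run, List.foldl_append]
    change (evalReverse q R g).step ((evalReverse q R g).run w.reverse) d = _
    rw [ih, ← List.singleton_append, baseValue_append]
    ext
    · simp [evalReverse, baseValue]
      ring
    · simp [evalReverse]
      ring

theorem complexity_le_of_natCast {R : Type*} [CommSemiring R] [Finite R] (q : ℕ) (g : R → Del)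
    (h : ∀ n : ℕ, g n = a n) :
    reverseComplexity q a ≤ (Nat.card (R × R) : ℕ) ∧ forwardComplexity q a ≤ (Nat.card R : ℕ) := by
  constructor
  · refine reverseComplexity_le_card (M := evalReverse q R g) fun w => ?_
    rw [DFAO.reverseFun, evalReverse_run]
    exact h _
  · refine forwardComplexity_le_card (M := evalForward q R g) fun w => ?_
    rw [DFAO.forwardFun, evalForward_run]
    exact h _

end Complexity

/-! ### Finite quotient semirings of `ℕ`. -/

section MonogenicSemirings

/-- The congruence on `ℕ` that identifies the integers from `n₀` on that are congruent
modulo `m`. -/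
def natRingCon (n₀ m : ℕ) : RingCon ℕ where
  r x y := x = y ∨ n₀ ≤ x ∧ n₀ ≤ y ∧ x ≡ y [MOD m]
  iseqv := by
    refine ⟨fun x => Or.inl rfl, ?_, ?_⟩
    · rintro x y (rfl | ⟨hx, hy, h⟩)
      · exact Or.inl rfl
      · exact Or.inr ⟨hy, hx, h.symm⟩
    · rintro x y z (rfl | ⟨hx, hy, h⟩) (rfl | ⟨hy', hz, h'⟩)
      · exact Or.inl rfl
      · exact Or.inr ⟨hy', hz, h'⟩
      · exact Or.inr ⟨hx, hy, h⟩
      · exact Or.inr ⟨hx, hz, h.trans h'⟩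
  add' := by
    rintro x y z w (rfl | ⟨hx, hy, h⟩) (rfl | ⟨hz, hw, h'⟩)
    · exact Or.inl rfl
    · exact Or.inr ⟨by omega, by omega, h'.add_left _⟩
    · exact Or.inr ⟨by omega, by omega, h.add_right _⟩
    · exact Or.inr ⟨by omega, by omega, h.add h'⟩
  mul' := by
    have hle : ∀ {x z : ℕ}, n₀ ≤ z → 0 < x → n₀ ≤ x * z := fun hz hx =>
      hz.trans (Nat.le_mul_of_pos_left _ hx)
    rintro x y z w (rfl | ⟨hx, hy, h⟩) (rfl | ⟨hz, hw, h'⟩)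
    · exact Or.inl rfl
    -- Only multiplication by `0` can leave the tail, and then both products are `0`.
    · rcases Nat.eq_zero_or_pos x with rfl | hx
      · simp
      · exact Or.inr ⟨hle hz hx, hle hw hx, h'.mul_left _⟩
    · rcases Nat.eq_zero_or_pos z with rfl | hz
      · simp
      · rw [mul_comm x, mul_comm y]
        exact Or.inr ⟨hle hx hz, hle hy hz, h.mul_left _⟩
    · have hsq : ∀ {x z : ℕ}, n₀ ≤ x → n₀ ≤ z → n₀ ≤ x * z := fun {x z} hx hz => by
        rcases Nat.eq_zero_or_pos x with rfl | hx0
        · omega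
        · exact hle hz hx0
      exact Or.inr ⟨hsq hx hz, hsq hy hw, h.mul h'⟩

theorem finite_natRingCon_quotient (n₀ : ℕ) {m : ℕ} (hm : 0 < m) :
    Finite (natRingCon n₀ m).Quotient := by
  refine Finite.of_surjective
    (fun i : Fin (n₀ + m) => ((i : ℕ) : (natRingCon n₀ m).Quotient)) fun z => ?_
  obtain ⟨n, rfl⟩ := (natRingCon n₀ m).mk'_surjective z
  rcases lt_or_ge n n₀ with hn | hn
  · exact ⟨⟨n, by omega⟩, by simp⟩
  · have hlt := Nat.mod_lt (n - n₀) hm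
    refine ⟨⟨n₀ + (n - n₀) % m, by omega⟩, ?_⟩
    refine ((natRingCon n₀ m).eq).2 (Or.inr ⟨by simp, hn, ?_⟩)
    have := (Nat.mod_modEq (n - n₀) m).add_left n₀
    rwa [Nat.add_sub_cancel' hn] at this

theorem eq_of_natRingCon {V : Type*} {a : ℕ → V} {n₀ m : ℕ} (ha : ∀ n, n₀ ≤ n → a (n + m) = a n)
    {x y : ℕ} (h : natRingCon n₀ m x y) : a x = a y := by
  have hmul : ∀ k n, n₀ ≤ n → a (n + m * k) = a n := by
    intro k
    induction k with
    | zero => simp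
    | succ k ih =>
      intro n hn
      rw [mul_add, mul_one, ← add_assoc, ha _ (by omega), ih n hn]
  rcases h with rfl | ⟨hx, hy, h⟩
  · rfl
  wlog hxy : x ≤ y generalizing x y
  · exact (this hy hx h.symm (by omega)).symm
  obtain ⟨k, hk⟩ := (Nat.modEq_iff_dvd' hxy).1 h
  obtain rfl : y = x + m * k := by omega
  exact (hmul k x hx).symm

/-- Both complexities of an eventually periodic sequence are bounded in terms of its preperiod and
its period only. -/
theorem exists_complexity_bound (n₀ : ℕ) {m : ℕ} (hm : 0 < m) :
    ∃ C : ℕ, ∀ {V : Type*} (a : ℕ → V), (∀ n, n₀ ≤ n → a (n + m) = a n) →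
      ∀ q, reverseComplexity q a ≤ C ∧ forwardComplexity q a ≤ C := by
  have := finite_natRingCon_quotient n₀ hm
  set R := (natRingCon n₀ m).Quotient
  -- The square accounts for the reverse-reading automaton, which also stores the weight of the next
  -- digit.
  refine ⟨max (Nat.card (R × R)) (Nat.card R), fun a ha q => ?_⟩
  let g : R → _ := Quotient.lift a fun x y h => eq_of_natRingCon ha h
  have hg : ∀ n : ℕ, g n = a n := fun n => by
    rw [← map_natCast (natRingCon n₀ m).mk']
    rfl
  obtain ⟨h1, h2⟩ := complexity_le_of_natCast q g hg
  exact ⟨h1.trans (by exact_mod_cast le_max_left _ _),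
    h2.trans (by exact_mod_cast le_max_right _ _)⟩

end MonogenicSemirings

/-! ### From bounded complexity to eventual periodicity. -/

section BoundedComplexity

variable {K : Type*} [Field K] [NumberField K] {a : ℕ → K} {C : ℕ}

theorem one_lt_card_residueFieldAt (𝔭 : HeightOneSpectrum (𝓞 K)) :
    1 < Nat.card (ResidueFieldAt K 𝔭) :=
  Finite.one_lt_card

theorem lt_card_residueFieldAt {𝔭 : HeightOneSpectrum (𝓞 K)} {N : ℕ}
    (h : ∀ m : ℕ, 0 < m → m ≤ N → 𝔭.valuation K (m : K) = 1) :
    N < Nat.card (ResidueFieldAt K 𝔭) := by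
  have h1 := one_lt_card_residueFieldAt 𝔭
  by_contra! hle
  -- A cardinality `q ≤ N` would be prime to itself.
  have := coprime_card_residueFieldAt (h _ (by omega) hle)
  rw [Nat.coprime_self] at this
  omega

theorem exists_mem_forall_valuation_natCast_eq_one {T : Set (HeightOneSpectrum (𝓞 K))}
    (hT : T.Infinite) {F : Set K} (hF : F.Finite) (N : ℕ) :
    ∃ 𝔭 ∈ T, (∀ x ∈ F, x ≠ 0 → 𝔭.valuation K x = 1) ∧
      ∀ m : ℕ, 0 < m → m ≤ N → 𝔭.valuation K (m : K) = 1 := by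
  obtain ⟨𝔭, h𝔭, h⟩ := exists_mem_forall_valuation_eq_one hT
    (F := (F ∪ (Nat.cast : ℕ → K) '' Set.Iic N) \ {0})
    ((hF.union ((Set.finite_Iic N).image _)).sdiff) fun x hx => hx.2
  refine ⟨𝔭, h𝔭, fun x hx hx0 => h x ⟨Or.inl hx, hx0⟩, fun m hm hmN => ?_⟩
  exact h m ⟨Or.inr ⟨m, hmN, rfl⟩, by simpa using hm.ne'⟩

/-- Given `C + 1` distinct values, some `𝔭` keeps them distinct and has `q` above their indices,
against the bound on the number of values among the first `q` terms. -/
theorem finite_range_of_complexity_le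
    (hinf : {𝔭 : HeightOneSpectrum (𝓞 K) | IntegralAt a 𝔭}.Infinite)
    (hC : ∀ (𝔭 : HeightOneSpectrum (𝓞 K)) (h : IntegralAt a 𝔭),
      reverseComplexity (Nat.card (ResidueFieldAt K 𝔭)) (reduceAt a 𝔭 h) ≤ C) :
    (Set.range a).Finite := by
  by_contra hrange
  obtain ⟨T, hT, hcard⟩ := Set.Infinite.exists_subset_card_eq hrange (C + 1)
  have hsec : ∀ x ∈ T, ∃ i, a i = x := fun x hx => hT hx
  choose! f hf using hsec
  have hinj : Set.InjOn f T := fun x hx y hy hxy => by rw [← hf x hx, ← hf y hy, hxy]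
  classical
  obtain ⟨𝔭, h𝔭, hF, hN⟩ := exists_mem_forall_valuation_natCast_eq_one hinf
    ((T.finite_toSet).image2 (fun x y => x - y) T.finite_toSet) ((T.image f).sup id)
  have hq := lt_card_residueFieldAt hN
  obtain ⟨i, hi, j, hj, hne, hij⟩ := exists_ne_eq_of_reverseComplexity_le (S := T.image f)
    (one_lt_card_residueFieldAt 𝔭) (hC 𝔭 h𝔭)
    (by rw [Finset.card_image_of_injOn hinj, hcard]; omega)
    fun i hi => (Finset.le_sup (f := id) hi).trans_lt hq
  obtain ⟨x, hx, rfl⟩ := Finset.mem_image.1 hi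
  obtain ⟨y, hy, rfl⟩ := Finset.mem_image.1 hj
  rw [reduceAt_eq_iff h𝔭, hf x hx, hf y hy] at hij
  · exact hne (by rw [hij])
  · rw [hf x hx, hf y hy]
    exact fun h => hF _ ⟨x, hx, y, hy, rfl⟩ (sub_ne_zero.2 h)

theorem eventuallyPeriodic_of_complexity_le
    (hinf : {𝔭 : HeightOneSpectrum (𝓞 K) | IntegralAt a 𝔭}.Infinite)
    (hC : ∀ (𝔭 : HeightOneSpectrum (𝓞 K)) (h : IntegralAt a 𝔭),
      reverseComplexity (Nat.card (ResidueFieldAt K 𝔭)) (reduceAt a 𝔭 h) ≤ C ∧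
      forwardComplexity (Nat.card (ResidueFieldAt K 𝔭)) (reduceAt a 𝔭 h) ≤ C) :
    EventuallyPeriodic a := by
  have hrange := finite_range_of_complexity_le hinf fun 𝔭 h => (hC 𝔭 h).1
  refine eventuallyPeriodic_of_forwardClasses (C := C) fun N => ?_
  -- The bound `N` gives coprimality; the bound `C` gives `C < q`, hence two equal columns.
  obtain ⟨𝔭, h𝔭, hF, hN⟩ := exists_mem_forall_valuation_natCast_eq_one hinf
    (hrange.image2 (fun x y => x - y) hrange) (max N C)
  have hiff : ∀ i j, reduceAt a 𝔭 h𝔭 i = reduceAt a 𝔭 h𝔭 j ↔ a i = a j := fun i j =>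
    reduceAt_eq_iff h𝔭 fun hne =>
      hF _ ⟨a i, ⟨i, rfl⟩, a j, ⟨j, rfl⟩, rfl⟩ (sub_ne_zero.2 hne)
  have hq := one_lt_card_residueFieldAt 𝔭
  refine ⟨_, hq, fun m hm hmN =>
    coprime_card_residueFieldAt (hN m hm (hmN.trans (le_max_left _ _))), ?_, ?_⟩
  · obtain ⟨σ, hσ⟩ := hasForwardClasses_of_forwardComplexity_le hq (hC 𝔭 h𝔭).2
    exact ⟨σ, fun n n' hn k i hi => (hiff _ _).1 (hσ n n' hn k i hi)⟩
  · obtain ⟨h, hh, d, hd⟩ := exists_hasEqualColumns hq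
      ((le_max_right N C).trans_lt (lt_card_residueFieldAt hN)) (hC 𝔭 h𝔭).1
    exact ⟨h, hh, d, fun n hn => (hiff _ _).1 (hd n hn)⟩

end BoundedComplexity

theorem mainTheorem4 {K : Type*} [Field K] [NumberField K] (a : ℕ → K) (y : PowerSeries K)
    (hy : y = PowerSeries.mk a) :
    (({𝔭 : HeightOneSpectrum (𝓞 K) | IntegralAt a 𝔭}.Infinite ∧
        ∃ C : ℕ, ∀ (𝔭 : HeightOneSpectrum (𝓞 K)) (h : IntegralAt a 𝔭),
          reverseComplexity (Nat.card (ResidueFieldAt K 𝔭)) (reduceAt a 𝔭 h) ≤ C ∧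
          forwardComplexity (Nat.card (ResidueFieldAt K 𝔭)) (reduceAt a 𝔭 h) ≤ C) ↔
      IsRationalWithSimplePolesAtRootsOfUnity y) ∧
    (IsRationalWithSimplePolesAtRootsOfUnity y →
      {𝔭 : HeightOneSpectrum (𝓞 K) | ¬ IntegralAt a 𝔭}.Finite) := by
  subst hy
  have hfin : IsRationalWithSimplePolesAtRootsOfUnity (PowerSeries.mk a) →
      {𝔭 : HeightOneSpectrum (𝓞 K) | ¬ IntegralAt a 𝔭}.Finite := fun h =>
    finite_setOf_not_integralAt (EventuallyPeriodic.of_isRational h).finite_range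
  refine ⟨⟨fun ⟨hinf, C, hC⟩ => (eventuallyPeriodic_of_complexity_le hinf hC).isRational,
    fun h => ⟨?_, ?_⟩⟩, hfin⟩
  · have := (hfin h).infinite_compl
    simpa [Set.compl_ofPred] using this
  · obtain ⟨n₀, m, hm, ha⟩ := EventuallyPeriodic.of_isRational h
    obtain ⟨C, hC⟩ := exists_complexity_bound n₀ hm
    refine ⟨C, fun 𝔭 hint => hC _ (fun n hn => ?_) _⟩
    simp only [reduceAt, ha n hn]
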